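/- Let $\chi_1,\chi_2$ be primitive Dirichlet characters modulo $q_1,q_2>1$, let $k\ge 3$ be an integer with $\chi_1(-1)\chi_2(-1)=(-1)^k$, and for $\operatorname{Im} z>0$ let $$E_{\chi_1,\chi_2,k}(z)=\frac12\sum_{\substack{c,d\in\mathbb Z\\ \gcd(c,d)=1}}\frac{\chi_1(c)\chi_2(d)}{(cq_2z+d)^k}.$$ There exist absolute constants $\varepsilon>0$ and $K$ such that the following holds for all such $q_1,q_2,\chi_1,\chi_2$ and all such $k\ge K$. Let $\ell\ge 1$ be an integer with $\gcd(\ell,q_2)=\gcd(\ell+1,q_2)=1$ and $\ell\le\varepsilon\sqrt k$. Then, counting zeros with multiplicity, $E_{\chi_1,\chi_2,k}$ has exactly one zero $z=x+iy$ in the region $$-\tfrac12<x\le\tfrac12,\qquad \frac{k-1}{2\pi(\ell+1)}\le y\le\frac{k-1}{2\pi\ell}.$$ Moreover, if $x_0\in(-\tfrac12,\tfrac12]$ is the number with $e^{2\pi i x_0}=-\overline{\chi_2(\ell)}\,\chi_2(\ell+1)$, then, again counting zeros with multiplicity, $E_{\chi_1,\chi_2,k}$ has exactly one zero in the closed rectangle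 $$x_0-\tfrac12\le x\le x_0+\tfrac12,\qquad \frac{k-1}{2\pi(\ell+1)}\le y\le\frac{k-1}{2\pi\ell}.$$ -/

import Mathlib

noncomputable section

/-- The newform Eisenstein series of weight `k` attached to the Dirichlet characters `χ₁` mod `q₁`
and `χ₂` mod `q₂`, namely `(1/2) ∑ χ₁(c) χ₂(d) / (c q₂ z + d) ^ k` over all pairs of coprime
integers `(c, d)`. For `k ≥ 3` and `Im z > 0` the series converges absolutely. -/
def newformEisenstein {q₁ q₂ : ℕ} (χ₁ : DirichletCharacter ℂ q₁) (χ₂ : DirichletCharacter ℂ q₂)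
    (k : ℕ) (z : ℂ) : ℂ :=
  (1 / 2) * ∑' v : {v : ℤ × ℤ // IsCoprime v.1 v.2},
    χ₁ (v.1.1 : ZMod q₁) * χ₂ (v.1.2 : ZMod q₂) /
      ((v.1.1 : ℂ) * (q₂ : ℂ) * z + (v.1.2 : ℂ)) ^ k

/-- The height `y_n = (k - 1) / (2 π n)`. -/
def yHeight (k n : ℕ) : ℝ := ((k : ℝ) - 1) / (2 * Real.pi * (n : ℝ))

/-- The points `x + i y` with `-1/2 < x ≤ 1/2` and `y_{ℓ+1} ≤ y ≤ y_ℓ`. -/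
def stripRegion (k l : ℕ) : Set ℂ :=
  {z : ℂ | -(1 / 2 : ℝ) < z.re ∧ z.re ≤ 1 / 2 ∧ yHeight k (l + 1) ≤ z.im ∧ z.im ≤ yHeight k l}

/-- The closed rectangle of points `x + i y` with `x₀ - 1/2 ≤ x ≤ x₀ + 1/2` and
`y_{ℓ+1} ≤ y ≤ y_ℓ`. -/
def centredRegion (x₀ : ℝ) (k l : ℕ) : Set ℂ :=
  {z : ℂ | x₀ - 1 / 2 ≤ z.re ∧ z.re ≤ x₀ + 1 / 2 ∧
    yHeight k (l + 1) ≤ z.im ∧ z.im ≤ yHeight k l}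

/-- `f` has exactly one zero in `S`, counted with multiplicity: there is a unique zero of `f` in
`S`, `f` is analytic there, and it vanishes to order one. -/
def HasExactlyOneZeroIn (f : ℂ → ℂ) (S : Set ℂ) : Prop :=
  ∃ z ∈ S, f z = 0 ∧ analyticOrderAt f z = 1 ∧ ∀ w ∈ S, f w = 0 → w = z

end

open Complex Metric

/-! Put `N = k - 1` and `w = e ^ (2 π i z)`. Up to a nonzero constant, the Eisenstein series is
`F(w) = ∑ m ^ N b_m w ^ m`, where `b_m` is the sum of `χ₁(c) χ₂⁻¹(d) / c ^ N` over `c d = m` and so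
lies within 1/100 of `χ₂⁻¹(m)` (`exists_newformEisenstein_eq_weightedPowerSeries`,
`norm_twistedDivisorSum_sub_le`). The heights `y_l` and `y_{l+1}` become the circles `|w| = e ^
(-N/l)` and `|w| = e ^ (-N/(l+1))`.

For `ρ` between these radii, `m ^ N ρ ^ m` as a function of real `m` peaks between `l` and `l + 1`.
Since `N` is at least `40 (l + 1) ^ 2`, consecutive terms away from the peak differ by a factor of
at least 10000, so only the terms of index `l` and `l + 1` matter
(`norm_weightedPowerSeries_sub_le`). Coprimality to `q₂` keeps `b_l` and `b_{l+1}` away from zero.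
Dividing by the term of index `l` leaves a small perturbation of `1 - w / w₁`. It has one zero in
the annulus, a simple one close to `w₁` (`exists_unique_zero_weightedPowerSeries`).

The half-open strip is a fundamental domain for `z ↦ e ^ (2 π i z)`, which is locally biholomorphic,
so the zero lifts uniquely and stays simple. In the closed rectangle the two vertical edges have the
same image. However, `w₁` is nearly a positive multiple of `e ^ (2 π i x₀)`, while the edges map to
negative multiples, so the zero is not on an edge (`ne_neg_real_mul`). -/

/-! ### Second-order bounds for `(1 ± x) ^ N`. -/

theorem exp_neg_ten_le : Real.exp (-10) ≤ 1 / 10000 := by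
  rw [Real.exp_neg, show (10 : ℝ) = (10 : ℕ) * 1 by norm_num, Real.exp_nat_mul, one_div]
  gcongr
  calc (10000 : ℝ) ≤ 2.7 ^ 10 := by norm_num
    _ ≤ _ := by
      gcongr
      exact le_of_lt (lt_trans (by norm_num) Real.exp_one_gt_d9)

/-- The quadratic saving over `1 + x ≤ e ^ x` is what separates consecutive terms: raised to the
power `N` it gains `e ^ (-N x ^ 2 / 4)`. -/
theorem one_add_le_exp_sub_sq {x : ℝ} (h0 : 0 ≤ x) (h1 : x ≤ 1) :
    1 + x ≤ Real.exp (x - x ^ 2 / 4) := by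
  have hu : 0 ≤ x - x ^ 2 / 4 := by nlinarith
  refine le_trans ?_ (Real.quadratic_le_exp_of_nonneg hu)
  nlinarith [mul_nonneg (sq_nonneg x) (by nlinarith : 0 ≤ (1 - x / 4) ^ 2 / 2 - 1 / 4)]

theorem one_sub_le_exp_neg_sub_sq {x : ℝ} (h0 : 0 ≤ x) (h1 : x ≤ 1) :
    1 - x ≤ Real.exp (-x - x ^ 2 / 4) := by
  have h := Real.exp_bound' h0 h1 (n := 2) (by norm_num)
  norm_num [Finset.sum_range_succ] at h
  have h2 : (1 - x) * Real.exp x ≤ Real.exp (-(x ^ 2 / 4)) := by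
    refine le_trans (mul_le_mul_of_nonneg_left h (by linarith)) ?_
    refine le_trans ?_ (Real.add_one_le_exp _)
    nlinarith [pow_nonneg h0 3]
  rw [show -x - x ^ 2 / 4 = -(x ^ 2 / 4) + -x by ring, Real.exp_add, Real.exp_neg x,
    ← div_eq_mul_inv, le_div_iff₀ (Real.exp_pos x)]
  exact h2

theorem exp_nat_mul_sub_sq_le {N : ℕ} {x u : ℝ} (hN : 40 ≤ N * x ^ 2) :
    Real.exp (u - x ^ 2 / 4) ^ N ≤ Real.exp (N * u) / 10000 := by
  rw [← Real.exp_nat_mul, show (N : ℝ) * (u - x ^ 2 / 4) = N * u + -(N * x ^ 2 / 4) by ring,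
    Real.exp_add, div_eq_mul_one_div (Real.exp _)]
  exact mul_le_mul_of_nonneg_left
    ((Real.exp_le_exp.mpr (by linarith : -(N * x ^ 2 / 4) ≤ -10)).trans exp_neg_ten_le)
    (Real.exp_pos _).le

theorem one_add_pow_le {N : ℕ} {x : ℝ} (h0 : 0 ≤ x) (h1 : x ≤ 1) (hN : 40 ≤ N * x ^ 2) :
    (1 + x) ^ N ≤ Real.exp (N * x) / 10000 :=
  (pow_le_pow_left₀ (by linarith) (one_add_le_exp_sub_sq h0 h1) N).trans
    (exp_nat_mul_sub_sq_le hN)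

theorem one_sub_pow_le {N : ℕ} {x : ℝ} (h0 : 0 ≤ x) (h1 : x ≤ 1) (hN : 40 ≤ N * x ^ 2) :
    (1 - x) ^ N ≤ Real.exp (-(N * x)) / 10000 := by
  rw [← mul_neg]
  exact (pow_le_pow_left₀ (by linarith) (one_sub_le_exp_neg_sub_sq h0 h1) N).trans
    (exp_nat_mul_sub_sq_le hN)

/-! ### Growth and decay of the terms `m ^ N ρ ^ m`. -/

theorem forty_le_mul_inv_sq {N l : ℕ} (hl : 1 ≤ l) (hN : 40 * (l + 1) ^ 2 ≤ N) :
    40 ≤ (N : ℝ) * (1 / (l : ℝ)) ^ 2 ∧ 40 ≤ (N : ℝ) * (1 / ((l : ℝ) + 1)) ^ 2 := by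
  have hl' : (1 : ℝ) ≤ l := by exact_mod_cast hl
  have hN' : (40 : ℝ) * (l + 1) ^ 2 ≤ N := by exact_mod_cast hN
  constructor
  · rw [div_pow, one_pow, mul_one_div, le_div_iff₀ (by positivity)]
    nlinarith
  · rw [div_pow, one_pow, mul_one_div, le_div_iff₀ (by positivity)]
    linarith

/-- Beyond `l + 1` the terms `m ^ N ρ ^ m` decay geometrically. -/
theorem pow_mul_pow_succ_le {N l m : ℕ} {ρ : ℝ} (hl : 1 ≤ l) (hN : 40 * (l + 1) ^ 2 ≤ N)
    (h0 : 0 < ρ) (hρ : ρ ≤ Real.exp (-(N / (l + 1)))) (hm : l + 1 ≤ m) :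
    ((m + 1 : ℕ) : ℝ) ^ N * ρ ^ (m + 1) ≤ ((m : ℝ) ^ N * ρ ^ m) / 10000 := by
  have hl' : (1 : ℝ) ≤ l := by exact_mod_cast hl
  have hm' : (l : ℝ) + 1 ≤ m := by exact_mod_cast hm
  have hm0 : (0 : ℝ) < m := by linarith
  have key := one_add_pow_le (N := N) (x := 1 / ((l : ℝ) + 1)) (by positivity)
    (by rw [div_le_one (by positivity)]; linarith) (forty_le_mul_inv_sq hl hN).2
  have h1 : (1 + 1 / (m : ℝ)) ^ N * ρ ≤ 1 / 10000 := by
    calc (1 + 1 / (m : ℝ)) ^ N * ρ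
        ≤ (1 + 1 / ((l : ℝ) + 1)) ^ N * Real.exp (-(N / (l + 1))) := by gcongr
      _ ≤ Real.exp (N * (1 / (l + 1))) / 10000 * Real.exp (-(N / (l + 1))) := by gcongr
      _ = 1 / 10000 := by
        rw [div_mul_eq_mul_div, ← Real.exp_add, mul_one_div, add_neg_cancel, Real.exp_zero]
  have h2 : ((m + 1 : ℕ) : ℝ) = m * (1 + 1 / m) := by push_cast; field_simp
  calc ((m + 1 : ℕ) : ℝ) ^ N * ρ ^ (m + 1)
      = (m : ℝ) ^ N * ρ ^ m * ((1 + 1 / (m : ℝ)) ^ N * ρ) := by rw [h2, mul_pow]; ring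
    _ ≤ (m : ℝ) ^ N * ρ ^ m * (1 / 10000) := by gcongr
    _ = _ := by ring

/-- Up to `l` the terms `m ^ N ρ ^ m` grow geometrically. -/
theorem pow_mul_pow_le_succ {N l m : ℕ} {ρ : ℝ} (hl : 1 ≤ l) (hN : 40 * (l + 1) ^ 2 ≤ N)
    (hρ : Real.exp (-(N / l)) ≤ ρ) (hm : m + 1 ≤ l) :
    (m : ℝ) ^ N * ρ ^ m ≤ (((m + 1 : ℕ) : ℝ) ^ N * ρ ^ (m + 1)) / 10000 := by
  have hl' : (1 : ℝ) ≤ l := by exact_mod_cast hl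
  have hm' : (m : ℝ) + 1 ≤ l := by exact_mod_cast hm
  have h0 : 0 < ρ := (Real.exp_pos _).trans_le hρ
  have key := one_sub_pow_le (N := N) (x := 1 / (l : ℝ)) (by positivity)
    (by rw [div_le_one (by positivity)]; linarith) (forty_le_mul_inv_sq hl hN).1
  have hnn : (0 : ℝ) ≤ 1 - 1 / ((m : ℝ) + 1) := by
    rw [sub_nonneg, div_le_one (by positivity)]; linarith [(Nat.cast_nonneg m : (0 : ℝ) ≤ m)]
  have h1 : (1 - 1 / ((m : ℝ) + 1)) ^ N ≤ ρ / 10000 := by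
    calc (1 - 1 / ((m : ℝ) + 1)) ^ N ≤ (1 - 1 / (l : ℝ)) ^ N := by gcongr
      _ ≤ _ := key
      _ ≤ _ := by rw [mul_one_div]; gcongr
  have h2 : (m : ℝ) = (m + 1) * (1 - 1 / (m + 1)) := by field_simp; ring
  calc (m : ℝ) ^ N * ρ ^ m
      = ((m : ℝ) + 1) ^ N * ρ ^ m * (1 - 1 / ((m : ℝ) + 1)) ^ N := by
        nth_rewrite 1 [h2]; rw [mul_pow]; ring
    _ ≤ ((m : ℝ) + 1) ^ N * ρ ^ m * (ρ / 10000) := by gcongr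
    _ = _ := by push_cast; ring

/-- Each term is at most 1/10000 of the next; doubling this ratio to 1/5000 leaves room for all
earlier terms and closes the induction. -/
theorem sum_range_pow_mul_pow_le {N l n : ℕ} {ρ : ℝ} (hl : 1 ≤ l) (hN : 40 * (l + 1) ^ 2 ≤ N)
    (hρ : Real.exp (-(N / l)) ≤ ρ) (hn : n ≤ l) :
    ∑ m ∈ Finset.range n, (m : ℝ) ^ N * ρ ^ m ≤ ((n : ℝ) ^ N * ρ ^ n) / 5000 := by
  have h0 : 0 < ρ := (Real.exp_pos _).trans_le hρ
  induction n with
  | zero => simp; positivity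
  | succ n ih =>
    rw [Finset.sum_range_succ]
    have h1 := ih (by omega)
    have h2 := pow_mul_pow_le_succ hl hN hρ hn
    have h3 : 0 ≤ (n : ℝ) ^ N * ρ ^ n := by positivity
    linarith

theorem tsum_tail_pow_mul_pow_le {N l : ℕ} {ρ : ℝ} (hl : 1 ≤ l) (hN : 40 * (l + 1) ^ 2 ≤ N)
    (h0 : 0 < ρ) (hρ : ρ ≤ Real.exp (-(N / (l + 1)))) :
    ∑' j : ℕ, ((j + (l + 2) : ℕ) : ℝ) ^ N * ρ ^ (j + (l + 2)) ≤
      (((l + 1 : ℕ) : ℝ) ^ N * ρ ^ (l + 1)) / 5000 := by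
  set a := ((l + 1 : ℕ) : ℝ) ^ N * ρ ^ (l + 1) with ha
  have ha0 : 0 ≤ a := by positivity
  have hle (j : ℕ) : ((j + (l + 1) : ℕ) : ℝ) ^ N * ρ ^ (j + (l + 1)) ≤ (1 / 10000) ^ j * a := by
    induction j with
    | zero => simp [ha]
    | succ j ih =>
      have := pow_mul_pow_succ_le hl hN h0 hρ (m := j + (l + 1)) (by omega)
      rw [show j + 1 + (l + 1) = j + (l + 1) + 1 by ring, pow_succ (1 / 10000 : ℝ)]
      linarith
  have hgeo : HasSum (fun j : ℕ => (1 / 10000 : ℝ) ^ j * (a / 10000)) (10000 / 9999 * (a / 10000)) :=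
    by
    have := (hasSum_geometric_of_lt_one (r := (1 / 10000 : ℝ)) (by norm_num)
      (by norm_num)).mul_right (a / 10000)
    norm_num at this ⊢
    exact this
  have hle' (j : ℕ) : ((j + (l + 2) : ℕ) : ℝ) ^ N * ρ ^ (j + (l + 2)) ≤
      (1 / 10000) ^ j * (a / 10000) := by
    have := hle (j + 1)
    rw [show j + 1 + (l + 1) = j + (l + 2) by ring, pow_succ] at this
    linarith
  have hs : Summable fun j : ℕ => ((j + (l + 2) : ℕ) : ℝ) ^ N * ρ ^ (j + (l + 2)) :=
    Summable.of_nonneg_of_le (fun j => by positivity) hle' hgeo.summable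
  have := hs.tsum_le_tsum hle' hgeo.summable
  rw [hgeo.tsum_eq] at this
  linarith

/-! ### The power series in the annulus, and perturbations of `1 - s`. -/

/-- The power series `∑ m ^ N b_m w ^ m`. -/
noncomputable def weightedPowerSeries (N : ℕ) (b : ℕ → ℂ) (w : ℂ) : ℂ :=
  ∑' m : ℕ, (m : ℂ) ^ N * b m * w ^ m

theorem summable_weightedPowerSeries {N : ℕ} {b : ℕ → ℂ} {w : ℂ} (hb : ∀ m, ‖b m‖ ≤ 2)
    (hw : ‖w‖ < 1) : Summable fun m : ℕ => (m : ℂ) ^ N * b m * w ^ m := by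
  refine Summable.of_norm_bounded
    ((summable_pow_mul_geometric_of_norm_lt_one N (r := ‖w‖) (by simpa using hw)).mul_left 2)
    fun m => ?_
  rw [norm_mul, norm_mul, norm_pow, norm_pow, Complex.norm_natCast]
  calc (m : ℝ) ^ N * ‖b m‖ * ‖w‖ ^ m ≤ (m : ℝ) ^ N * 2 * ‖w‖ ^ m := by gcongr; exact hb m
    _ = _ := by ring

theorem differentiableOn_weightedPowerSeries {N : ℕ} {b : ℕ → ℂ} (hb : ∀ m, ‖b m‖ ≤ 2) :
    DifferentiableOn ℂ (weightedPowerSeries N b) (ball 0 1) := by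
  intro w hw
  have hw' : ‖w‖ < 1 := by simpa using hw
  obtain ⟨ρ, h1, h2⟩ := exists_between hw'
  have h0 : 0 ≤ ρ := (norm_nonneg w).trans h1.le
  have : DifferentiableOn ℂ (weightedPowerSeries N b) (ball 0 ρ) := by
    refine differentiableOn_tsum_of_summable_norm
      ((summable_pow_mul_geometric_of_norm_lt_one N (r := ρ)
        (by rwa [Real.norm_of_nonneg h0])).mul_left 2)
      (fun m => by fun_prop) isOpen_ball fun m v hv => ?_
    have hv' : ‖v‖ ≤ ρ := by simpa using (mem_ball.mp hv).le
    rw [norm_mul, norm_mul, norm_pow, norm_pow, Complex.norm_natCast]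
    calc (m : ℝ) ^ N * ‖b m‖ * ‖v‖ ^ m ≤ (m : ℝ) ^ N * 2 * ρ ^ m := by gcongr; exact hb m
      _ = _ := by ring
  exact (this.differentiableAt (isOpen_ball.mem_nhds (by simpa using h1))).differentiableWithinAt

/-- In the annulus the power series is dominated by its terms of index `l` and `l + 1`. -/
theorem norm_weightedPowerSeries_sub_le {N l : ℕ} {b : ℕ → ℂ} {w : ℂ} (hl : 1 ≤ l)
    (hN : 40 * (l + 1) ^ 2 ≤ N) (hb : ∀ m, ‖b m‖ ≤ 2)
    (h1 : Real.exp (-(N / l)) ≤ ‖w‖) (h2 : ‖w‖ ≤ Real.exp (-(N / (l + 1)))) :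
    ‖weightedPowerSeries N b w -
        ((l : ℂ) ^ N * b l * w ^ l + ((l + 1 : ℕ) : ℂ) ^ N * b (l + 1) * w ^ (l + 1))‖ ≤
      ((l : ℝ) ^ N * ‖w‖ ^ l + ((l + 1 : ℕ) : ℝ) ^ N * ‖w‖ ^ (l + 1)) / 2500 := by
  have hw0 : 0 < ‖w‖ := (Real.exp_pos _).trans_le h1
  have hN0 : 0 < N := lt_of_lt_of_le (by positivity) hN
  have hw1 : ‖w‖ < 1 := h2.trans_lt (by
    rw [Real.exp_lt_one_iff]; have : (0 : ℝ) < N := by exact_mod_cast hN0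
    rw [neg_lt_zero]; positivity)
  have hterm (m : ℕ) : ‖(m : ℂ) ^ N * b m * w ^ m‖ ≤ 2 * ((m : ℝ) ^ N * ‖w‖ ^ m) := by
    rw [norm_mul, norm_mul, norm_pow, norm_pow, Complex.norm_natCast]
    calc (m : ℝ) ^ N * ‖b m‖ * ‖w‖ ^ m ≤ (m : ℝ) ^ N * 2 * ‖w‖ ^ m := by gcongr; exact hb m
      _ = _ := by ring
  have hsum := summable_weightedPowerSeries (N := N) hb hw1
  have hsplit := hsum.sum_add_tsum_nat_add (l + 2)
  rw [Finset.sum_range_succ, Finset.sum_range_succ] at hsplit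
  have hφ : Summable fun j : ℕ => 2 * (((j + (l + 2) : ℕ) : ℝ) ^ N * ‖w‖ ^ (j + (l + 2))) :=
    ((summable_nat_add_iff (l + 2)).mpr
      (summable_pow_mul_geometric_of_norm_lt_one N (r := ‖w‖) (by simpa using hw1))).mul_left 2
  have htail := tsum_of_norm_bounded hφ.hasSum (fun j => hterm (j + (l + 2)))
  rw [tsum_mul_left] at htail
  have htail' := tsum_tail_pow_mul_pow_le hl hN hw0 h2
  have hhead : ‖∑ m ∈ Finset.range l, (m : ℂ) ^ N * b m * w ^ m‖ ≤
      2 * ∑ m ∈ Finset.range l, (m : ℝ) ^ N * ‖w‖ ^ m := by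
    rw [Finset.mul_sum]
    exact norm_sum_le_of_le _ fun m _ => hterm m
  have hhead' := sum_range_pow_mul_pow_le hl hN h1 le_rfl
  rw [weightedPowerSeries, ← hsplit]
  set S := ∑ m ∈ Finset.range l, (m : ℂ) ^ N * b m * w ^ m
  set T := ∑' j : ℕ, ((j + (l + 2) : ℕ) : ℂ) ^ N * b (j + (l + 2)) * w ^ (j + (l + 2))
  calc _ = ‖S + T‖ := by congr 1; ring
    _ ≤ ‖S‖ + ‖T‖ := norm_add_le _ _
    _ ≤ _ := by linarith

/-- A holomorphic perturbation of `1 - s` has exactly one zero near `1`, and it is simple. -/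
theorem exists_unique_zero_of_norm_sub_le {H : ℂ → ℂ} (hd : DifferentiableOn ℂ H (ball 1 (1 / 2)))
    (hH : ∀ s ∈ ball (1 : ℂ) (1 / 2), ‖H s - (1 - s)‖ ≤ 1 / 100) :
    ∃ s ∈ closedBall (1 : ℂ) (1 / 4), H s = 0 ∧
      (∀ t ∈ closedBall (1 : ℂ) (1 / 4), H t = 0 → t = s) ∧ deriv H s ≠ 0 := by
  obtain ⟨R, hR⟩ : ∃ R : ℂ → ℂ, ∀ s, R s = H s - (1 - s) := ⟨_, fun _ => rfl⟩
  have hRle (s) (hs : s ∈ ball (1 : ℂ) (1 / 2)) : ‖R s‖ ≤ 1 / 100 := hR s ▸ hH s hs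
  have hsub : closedBall (1 : ℂ) (1 / 4) ⊆ ball 1 (1 / 2) := closedBall_subset_ball (by norm_num)
  have hRd : DifferentiableOn ℂ R (ball 1 (1 / 2)) := by
    rw [funext hR]; exact hd.sub (by fun_prop)
  have hHs (s) : H s = (1 - s) + R s := by simp [hR]
  have hRdiff (s) (hs : s ∈ closedBall (1 : ℂ) (1 / 4)) : DifferentiableAt ℂ R s :=
    hRd.differentiableAt (isOpen_ball.mem_nhds (hsub hs))
  -- Cauchy's estimate on a circle of radius 1/5, which fits because `1/4 + 1/5 < 1/2`.
  have hderiv (s) (hs : s ∈ closedBall (1 : ℂ) (1 / 4)) : ‖deriv R s‖ ≤ 1 / 10 := by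
    have hsb : closedBall s (1 / 5) ⊆ ball (1 : ℂ) (1 / 2) := fun t ht => by
      rw [mem_ball]
      linarith [dist_triangle t s 1, mem_closedBall.mp ht, mem_closedBall.mp hs]
    have := norm_deriv_le_of_forall_mem_sphere_norm_le (c := s) (R := 1 / 5) (C := 1 / 100)
      (f := R) (by norm_num) ⟨(hRd.mono hsb).mono ball_subset_closedBall,
        by
          rw [closure_ball _ (by norm_num)]
          exact (hRd.mono hsb).continuousOn⟩
      fun t ht => hRle t (hsb (sphere_subset_closedBall ht))
    linarith
  have h1 : ‖R 1‖ ≤ 1 / 100 := hRle 1 (by simp)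
  have hex : (0 : ℂ) ∈ H '' closedBall 1 (1 / 4) := by
    -- Quantitative open mapping: `H` moves by at least `1/4 - 2/100 ≥ 1/5` on the circle, so the
    -- image contains the ball of radius 1/10 about `H 1`, hence 0.
    refine DiffContOnCl.ball_subset_image_closedBall (z₀ := 1) (r := 1 / 4) (ε := 1 / 5)
      ⟨hd.mono (ball_subset_closedBall.trans hsub), by
        rw [closure_ball _ (by norm_num)]
        exact (hd.mono hsub).continuousOn⟩ (by norm_num) (fun s hs => ?_) ?_ ?_
    · have h2 : ‖R s‖ ≤ 1 / 100 := hRle s (hsub (sphere_subset_closedBall hs))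
      have h3 : ‖s - 1‖ = 1 / 4 := by simpa [dist_eq_norm] using hs
      rw [hHs s, hHs 1]
      have h4 : ‖s - 1‖ ≤ ‖1 - s + R s - (1 - 1 + R 1)‖ + ‖R s‖ + ‖R 1‖ := by
        calc ‖s - 1‖ = ‖-(1 - s + R s - (1 - 1 + R 1)) + R s - R 1‖ := by congr 1; ring
          _ ≤ ‖-(1 - s + R s - (1 - 1 + R 1))‖ + ‖R s‖ + ‖R 1‖ :=
            (norm_sub_le _ _).trans (by gcongr; exact norm_add_le _ _)
          _ = _ := by rw [norm_neg]
      have h5 : 1 / 5 ≤ ‖1 - s + R s - (1 - 1 + R 1)‖ := by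
        generalize ‖1 - s + R s - (1 - 1 + R 1)‖ = A at *
        linarith
      exact h5
    · intro hev
      have hEq : Set.EqOn H (fun _ => H 1) (ball 1 (1 / 2)) :=
        (hd.analyticOnNhd isOpen_ball).eqOn_of_preconnected_of_eventuallyEq
          analyticOnNhd_const (convex_ball _ _).isPreconnected (z₀ := 1) (by simp)
          (hev.mono fun s hs => not_not.mp hs)
      have hmem : (5 / 4 : ℂ) ∈ ball (1 : ℂ) (1 / 2) := by
        rw [mem_ball, dist_eq_norm]; norm_num
      have h5 := hEq hmem
      have h6 : ‖R (5 / 4)‖ ≤ 1 / 100 := hRle _ hmem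
      simp only [] at h5
      rw [hHs, hHs 1] at h5
      have h7 : (1 / 4 : ℂ) = R (5 / 4) - R 1 := by linear_combination -h5
      have h8 : ‖(1 / 4 : ℂ)‖ ≤ 1 / 100 + 1 / 100 := by
        rw [h7]; exact (norm_sub_le _ _).trans (add_le_add h6 h1)
      norm_num at h8
    · rw [mem_ball, dist_eq_norm, hHs 1]
      simp only [sub_self, zero_add, zero_sub, norm_neg]
      linarith
  obtain ⟨s, hs, hs0⟩ := hex
  refine ⟨s, hs, hs0, fun t ht ht0 => ?_, fun hds => ?_⟩
  -- Two zeros satisfy `R t - R s = t - s`, but `R` is a contraction.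
  · have hlip := (convex_closedBall (1 : ℂ) (1 / 4)).norm_image_sub_le_of_norm_deriv_le
      hRdiff hderiv hs ht
    have : R t - R s = t - s := by
      rw [hHs] at ht0 hs0
      linear_combination ht0 - hs0
    rw [this] at hlip
    have h0 : ‖t - s‖ = 0 := le_antisymm (by linarith) (norm_nonneg _)
    exact sub_eq_zero.mp (norm_eq_zero.mp h0)
  · have : deriv R s = 1 := by
      have h : HasDerivAt R (deriv H s - (0 - 1)) s := by
        rw [funext hR]
        exact (hd.differentiableAt (isOpen_ball.mem_nhds (hsub hs))).hasDerivAt.sub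
          ((hasDerivAt_const s 1).sub (hasDerivAt_id s))
      rw [h.deriv, hds]; ring
    have h := hderiv s hs
    rw [this] at h
    norm_num at h

/-! ### The unique zero of the power series in the annulus. -/

/-- Up to the ratio of coefficients, `|w₁|` is `(l / (l + 1)) ^ N`. This bound and
`div_pow_le_exp_neg` put it inside the annulus with a factor 10000 to spare at either end. -/
theorem exp_neg_le_div_pow {N l : ℕ} (hl : 1 ≤ l) (hN : 40 * (l + 1) ^ 2 ≤ N) :
    10000 * Real.exp (-(N / l)) ≤ (l : ℝ) ^ N / ((l + 1 : ℕ) : ℝ) ^ N := by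
  have hl' : (1 : ℝ) ≤ l := by exact_mod_cast hl
  have key := one_add_pow_le (N := N) (x := 1 / (l : ℝ)) (by positivity)
    (by rw [div_le_one (by positivity)]; exact hl') (forty_le_mul_inv_sq hl hN).1
  rw [show 1 + 1 / (l : ℝ) = ((l + 1 : ℕ) : ℝ) / l by push_cast; field_simp, div_pow, mul_one_div,
    div_le_div_iff₀ (by positivity) (by positivity)] at key
  rw [Real.exp_neg, ← div_eq_mul_inv, div_le_div_iff₀ (Real.exp_pos _) (by positivity)]
  linarith

theorem div_pow_le_exp_neg {N l : ℕ} (hl : 1 ≤ l) (hN : 40 * (l + 1) ^ 2 ≤ N) :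
    (l : ℝ) ^ N / ((l + 1 : ℕ) : ℝ) ^ N ≤ Real.exp (-(N / (l + 1))) / 10000 := by
  have hl' : (1 : ℝ) ≤ l := by exact_mod_cast hl
  have key := one_sub_pow_le (N := N) (x := 1 / ((l : ℝ) + 1)) (by positivity)
    (by rw [div_le_one (by positivity)]; linarith) (forty_le_mul_inv_sq hl hN).2
  rwa [show 1 - 1 / ((l : ℝ) + 1) = (l : ℝ) / ((l + 1 : ℕ) : ℝ) by push_cast; field_simp; ring,
    div_pow, mul_one_div] at key

/-- Dividing by the term of index `l`, the power series becomes a small perturbation of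
`1 - w / w₁`, where `w₁` is the point at which the terms of index `l` and `l + 1` cancel. -/
theorem norm_weightedPowerSeries_div_sub_le {N l : ℕ} {b : ℕ → ℂ} {w A B : ℂ} (hl : 1 ≤ l)
    (hN : 40 * (l + 1) ^ 2 ≤ N) (hb : ∀ m, ‖b m‖ ≤ 2) (hbl : 1 / 2 ≤ ‖b l‖)
    (hbl' : 1 / 2 ≤ ‖b (l + 1)‖) (hA : A = (l : ℂ) ^ N * b l)
    (hB : B = ((l + 1 : ℕ) : ℂ) ^ N * b (l + 1))
    (h1 : Real.exp (-(N / l)) ≤ ‖w‖) (h2 : ‖w‖ ≤ Real.exp (-(N / (l + 1)))) :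
    ‖weightedPowerSeries N b w / (A * w ^ l) - (1 - w / (-A / B))‖ ≤
      (1 + ‖w / (-A / B)‖) / 1250 := by
  have hw0 : 0 < ‖w‖ := (Real.exp_pos _).trans_le h1
  have hw : w ≠ 0 := norm_pos_iff.mp hw0
  have hl0 : (0 : ℝ) < l := by exact_mod_cast hl
  have hnA : (l : ℝ) ^ N ≤ 2 * ‖A‖ := by
    rw [hA, norm_mul, norm_pow, Complex.norm_natCast]
    nlinarith [pow_pos hl0 N]
  have hnB : ((l + 1 : ℕ) : ℝ) ^ N ≤ 2 * ‖B‖ := by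
    rw [hB, norm_mul, norm_pow, Complex.norm_natCast]
    nlinarith [pow_pos (show (0 : ℝ) < ((l + 1 : ℕ) : ℝ) by positivity) N]
  have hA0 : 0 < ‖A‖ := by linarith [pow_pos hl0 N]
  have hB0 : 0 < ‖B‖ := by
    linarith [pow_pos (show (0 : ℝ) < ((l + 1 : ℕ) : ℝ) by positivity) N]
  have hA' : A ≠ 0 := norm_pos_iff.mp hA0
  have hB' : B ≠ 0 := norm_pos_iff.mp hB0
  have hmain := norm_weightedPowerSeries_sub_le hl hN hb h1 h2
  rw [← hA, ← hB] at hmain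
  have hx : weightedPowerSeries N b w / (A * w ^ l) - (1 - w / (-A / B)) =
      (weightedPowerSeries N b w - (A * w ^ l + B * w ^ (l + 1))) / (A * w ^ l) := by
    field_simp
    ring
  have hy : ‖w / (-A / B)‖ = ‖w‖ * ‖B‖ / ‖A‖ := by
    rw [norm_div, norm_div, norm_neg]; field_simp
  rw [hx, hy, norm_div, norm_mul, norm_pow, div_le_iff₀ (by positivity)]
  refine hmain.trans ?_
  calc ((l : ℝ) ^ N * ‖w‖ ^ l + ((l + 1 : ℕ) : ℝ) ^ N * ‖w‖ ^ (l + 1)) / 2500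
      ≤ (2 * ‖A‖ * ‖w‖ ^ l + 2 * ‖B‖ * ‖w‖ ^ (l + 1)) / 2500 := by gcongr
    _ = _ := by field_simp; ring

/-- The coefficient ratio lies in `[1/4, 4]` and `‖s‖` in `[1/2, 3/2]`, so together they cost a
factor between 1/8 and 6, well within the spare 10000. -/
theorem mem_annulus_of_mem_ball {N l : ℕ} {b : ℕ → ℂ} {s A B : ℂ} (hl : 1 ≤ l)
    (hN : 40 * (l + 1) ^ 2 ≤ N) (hb : ∀ m, ‖b m‖ ≤ 2) (hbl : 1 / 2 ≤ ‖b l‖)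
    (hbl' : 1 / 2 ≤ ‖b (l + 1)‖) (hA : A = (l : ℂ) ^ N * b l)
    (hB : B = ((l + 1 : ℕ) : ℂ) ^ N * b (l + 1)) (hs : s ∈ ball (1 : ℂ) (1 / 2)) :
    Real.exp (-(N / l)) ≤ ‖-A / B * s‖ ∧ ‖-A / B * s‖ ≤ Real.exp (-(N / (l + 1))) := by
  have hl0 : (0 : ℝ) < l := by exact_mod_cast hl
  have hs' : ‖s - 1‖ < 1 / 2 := by simpa [dist_eq_norm] using hs
  have hs1 : 1 / 2 ≤ ‖s‖ := by
    have := norm_sub_norm_le 1 s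
    rw [norm_sub_rev, norm_one] at this
    linarith
  have hs2 : ‖s‖ ≤ 3 / 2 := by
    have := norm_sub_norm_le s 1
    rw [norm_one] at this
    linarith
  set Q := (l : ℝ) ^ N / ((l + 1 : ℕ) : ℝ) ^ N with hQ
  have hQ0 : 0 < Q := by positivity
  have hn : ‖-A / B * s‖ = Q * (‖b l‖ / ‖b (l + 1)‖ * ‖s‖) := by
    rw [norm_mul, norm_div, norm_neg, hA, hB, norm_mul, norm_mul, norm_pow, norm_pow,
      Complex.norm_natCast, Complex.norm_natCast, hQ]
    field_simp
  have hc1 : 1 / 4 ≤ ‖b l‖ / ‖b (l + 1)‖ := by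
    rw [le_div_iff₀ (by linarith)]; linarith [hb (l + 1)]
  have hc2 : ‖b l‖ / ‖b (l + 1)‖ ≤ 4 := by
    rw [div_le_iff₀ (by linarith)]; linarith [hb l]
  have h1 := exp_neg_le_div_pow hl hN
  have h2 := div_pow_le_exp_neg hl hN
  rw [← hQ] at h1 h2
  rw [hn]
  constructor
  · calc Real.exp (-(N / l)) ≤ Q * (1 / 4 * (1 / 2)) := by
          linarith [Real.exp_pos (-((N : ℝ) / l))]
      _ ≤ _ := by gcongr
  · calc Q * (‖b l‖ / ‖b (l + 1)‖ * ‖s‖) ≤ Q * (4 * (3 / 2)) := by gcongr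
      _ ≤ _ := by linarith [Real.exp_pos (-((N : ℝ) / (l + 1)))]

theorem exists_unique_zero_weightedPowerSeries {N l : ℕ} {b : ℕ → ℂ} (hl : 1 ≤ l)
    (hN : 40 * (l + 1) ^ 2 ≤ N) (hb : ∀ m, ‖b m‖ ≤ 2) (hbl : 1 / 2 ≤ ‖b l‖)
    (hbl' : 1 / 2 ≤ ‖b (l + 1)‖) :
    ∃ w : ℂ, (Real.exp (-(N / l)) ≤ ‖w‖ ∧ ‖w‖ ≤ Real.exp (-(N / (l + 1)))) ∧
      weightedPowerSeries N b w = 0 ∧ deriv (weightedPowerSeries N b) w ≠ 0 ∧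
      (∀ v : ℂ, Real.exp (-(N / l)) ≤ ‖v‖ → ‖v‖ ≤ Real.exp (-(N / (l + 1))) →
        weightedPowerSeries N b v = 0 → v = w) ∧
      ∃ s : ℂ, ‖s - 1‖ ≤ 1 / 100 ∧
        ((l + 1 : ℕ) : ℂ) ^ N * b (l + 1) * w = -((l : ℂ) ^ N * b l * s) := by
  obtain ⟨A, hA⟩ : ∃ A, A = (l : ℂ) ^ N * b l := ⟨_, rfl⟩
  obtain ⟨B, hB⟩ : ∃ B, B = ((l + 1 : ℕ) : ℂ) ^ N * b (l + 1) := ⟨_, rfl⟩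
  obtain ⟨w₁, hw₁⟩ : ∃ w₁, w₁ = -A / B := ⟨_, rfl⟩
  have hA0 : A ≠ 0 := by
    rw [hA]
    exact mul_ne_zero (pow_ne_zero _ (by exact_mod_cast (by omega : l ≠ 0)))
      (norm_pos_iff.mp (by linarith))
  have hB0 : B ≠ 0 := by
    rw [hB]
    exact mul_ne_zero (pow_ne_zero _ (by exact_mod_cast (by omega : l + 1 ≠ 0)))
      (norm_pos_iff.mp (by linarith))
  have hw₁0 : w₁ ≠ 0 := hw₁ ▸ div_ne_zero (neg_ne_zero.mpr hA0) hB0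
  have hN0 : (0 : ℝ) < N := by exact_mod_cast lt_of_lt_of_le (by positivity) hN
  have hlt (w : ℂ) (h : ‖w‖ ≤ Real.exp (-(N / (l + 1)))) : w ∈ ball (0 : ℂ) 1 := by
    rw [mem_ball_zero_iff]
    exact h.trans_lt (by rw [Real.exp_lt_one_iff, neg_lt_zero]; positivity)
  have hball (s) (hs : s ∈ ball (1 : ℂ) (1 / 2)) := mem_annulus_of_mem_ball hl hN hb hbl hbl' hA hB hs
  have hest (w) (h1 : Real.exp (-(N / l)) ≤ ‖w‖) (h2 : ‖w‖ ≤ Real.exp (-(N / (l + 1)))) :=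
    norm_weightedPowerSeries_div_sub_le hl hN hb hbl hbl' hA hB h1 h2
  rw [← hw₁] at hball hest
  have hFd (w : ℂ) (h : ‖w‖ ≤ Real.exp (-(N / (l + 1)))) :
      DifferentiableAt ℂ (weightedPowerSeries N b) w :=
    (differentiableOn_weightedPowerSeries hb).differentiableAt (isOpen_ball.mem_nhds (hlt w h))
  obtain ⟨H, hH⟩ : ∃ H : ℂ → ℂ, ∀ s, H s =
    weightedPowerSeries N b (w₁ * s) / (A * (w₁ * s) ^ l) := ⟨_, fun _ => rfl⟩
  have hden (w : ℂ) (h : Real.exp (-(N / l)) ≤ ‖w‖) : A * w ^ l ≠ 0 :=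
    mul_ne_zero hA0 (pow_ne_zero _ (norm_pos_iff.mp ((Real.exp_pos _).trans_le h)))
  have hHderiv (s) (hs : s ∈ ball (1 : ℂ) (1 / 2)) : HasDerivAt H
      ((deriv (weightedPowerSeries N b) (w₁ * s) * w₁ * (A * (w₁ * s) ^ l) -
        weightedPowerSeries N b (w₁ * s) * deriv (fun t => A * (w₁ * t) ^ l) s) /
        (A * (w₁ * s) ^ l) ^ 2) s := by
    rw [funext hH]
    have h1 : HasDerivAt (fun t => w₁ * t) w₁ s := by simpa using (hasDerivAt_id s).const_mul w₁
    exact ((hFd _ (hball s hs).2).hasDerivAt.comp s h1).div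
      (DifferentiableAt.hasDerivAt (by fun_prop)) (hden _ (hball s hs).1)
  obtain ⟨s, hs, hs0, huniq, hds⟩ := exists_unique_zero_of_norm_sub_le (H := H)
    (fun s hs => (hHderiv s hs).differentiableAt.differentiableWithinAt) fun s hs => by
      have h := hest _ (hball s hs).1 (hball s hs).2
      rw [mul_div_cancel_left₀ _ hw₁0, ← hH] at h
      have : ‖s‖ ≤ 3 / 2 := by
        have h1 := norm_sub_norm_le s 1
        have h2 : ‖s - 1‖ < 1 / 2 := by simpa [dist_eq_norm] using hs
        rw [norm_one] at h1
        linarith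
      linarith
  have hs' : s ∈ ball (1 : ℂ) (1 / 2) := closedBall_subset_ball (by norm_num) hs
  have hF0 : weightedPowerSeries N b (w₁ * s) = 0 := by
    rw [hH, div_eq_zero_iff] at hs0
    exact hs0.resolve_right (hden _ (hball s hs').1)
  -- At a zero, `u = v / w₁` satisfies `‖u - 1‖ ≤ (1 + ‖u‖) / 1250`. This forces every zero of the
  -- annulus near `w₁`, so local uniqueness suffices.
  have hnear (v : ℂ) (h1 : Real.exp (-(N / l)) ≤ ‖v‖) (h2 : ‖v‖ ≤ Real.exp (-(N / (l + 1))))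
      (hv : weightedPowerSeries N b v = 0) : ‖v / w₁ - 1‖ ≤ 1 / 100 := by
    have h := hest v h1 h2
    rw [hv, zero_div, zero_sub, neg_sub] at h
    have h3 := norm_sub_norm_le (v / w₁) 1
    rw [norm_one] at h3
    linarith
  refine ⟨w₁ * s, hball s hs', hF0, fun hd => hds ?_, fun v h1 h2 hv => ?_, s, ?_, ?_⟩
  · rw [(hHderiv s hs').deriv, hd, hF0]; simp
  · have := huniq (v / w₁) (by
      rw [mem_closedBall, dist_eq_norm]; linarith [hnear v h1 h2 hv])
      (by rw [hH, mul_div_cancel₀ _ hw₁0, hv, zero_div])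
    rw [← this, mul_div_cancel₀ _ hw₁0]
  · have := hnear _ (hball s hs').1 (hball s hs').2 hF0
    rwa [mul_div_cancel_left₀ _ hw₁0] at this
  · rw [← hA, ← hB, hw₁]
    field_simp

/-! ### From coprime pairs to the full lattice sum. -/

/-- Summand of the newform Eisenstein series attached to a pair of integers. -/
noncomputable def newformSummand {q₁ q₂ : ℕ} (χ₁ : DirichletCharacter ℂ q₁)
    (χ₂ : DirichletCharacter ℂ q₂) (k : ℕ) (z : ℂ) (v : ℤ × ℤ) : ℂ :=
  χ₁ (v.1 : ZMod q₁) * χ₂ (v.2 : ZMod q₂) / ((v.1 : ℂ) * (q₂ : ℂ) * z + (v.2 : ℂ)) ^ k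

theorem norm_mul_dirichletCharacter_le_one {q₁ q₂ : ℕ} (χ₁ : DirichletCharacter ℂ q₁)
    (χ₂ : DirichletCharacter ℂ q₂) (a : ZMod q₁) (b : ZMod q₂) : ‖χ₁ a * χ₂ b‖ ≤ 1 := by
  rw [norm_mul]
  exact mul_le_one₀ (χ₁.norm_le_one a) (norm_nonneg _) (χ₂.norm_le_one b)

theorem natCast_mul_im_pos {n : ℕ} (hn : 0 < n) {z : ℂ} (hz : 0 < z.im) :
    0 < ((n : ℂ) * z).im := by
  have : (0 : ℝ) < n := by exact_mod_cast hn
  simp [Complex.mul_im]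
  positivity

section

variable {q₁ q₂ : ℕ} (χ₁ : DirichletCharacter ℂ q₁) (χ₂ : DirichletCharacter ℂ q₂) {k : ℕ} {z : ℂ}

theorem summable_norm_newformSummand (hq₂ : 0 < q₂) (hk : 3 ≤ k) (hz : 0 < z.im) :
    Summable fun v => ‖newformSummand χ₁ χ₂ k z v‖ := by
  have h := (summable_prod_eisSummand hk ⟨(q₂ : ℂ) * z, natCast_mul_im_pos hq₂ hz⟩).norm
  refine Summable.of_nonneg_of_le (fun _ => norm_nonneg _) (fun v => ?_) h
  rw [newformSummand, norm_div, EisensteinSeries.eisSummand]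
  simp only [Matrix.cons_val_zero, Matrix.cons_val_one, zpow_neg, zpow_natCast, norm_inv]
  rw [div_eq_mul_inv, ← mul_assoc]
  exact mul_le_of_le_one_left (by positivity) (norm_mul_dirichletCharacter_le_one χ₁ χ₂ _ _)

theorem newformSummand_neg (hpar : χ₁ (-1) * χ₂ (-1) = (-1) ^ k) (v : ℤ × ℤ) :
    newformSummand χ₁ χ₂ k z (-v) = newformSummand χ₁ χ₂ k z v := by
  simp only [newformSummand, Prod.fst_neg, Prod.snd_neg, Int.cast_neg]
  rw [← neg_one_mul (v.1 : ZMod q₁), ← neg_one_mul (v.2 : ZMod q₂), map_mul, map_mul,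
    show -(v.1 : ℂ) * (q₂ : ℂ) * z + -(v.2 : ℂ) = -1 * ((v.1 : ℂ) * (q₂ : ℂ) * z + v.2) by ring,
    mul_pow, mul_mul_mul_comm, hpar]
  exact mul_div_mul_left _ _ (pow_ne_zero _ (by norm_num))

theorem newformSummand_natMul (n : ℕ) (v : ℤ × ℤ) :
    newformSummand χ₁ χ₂ k z (n * v.1, n * v.2) =
      χ₁ (n : ZMod q₁) * χ₂ (n : ZMod q₂) / (n : ℂ) ^ k * newformSummand χ₁ χ₂ k z v := by
  simp only [newformSummand]
  push_cast
  rw [map_mul, map_mul, show (n : ℂ) * (v.1 : ℂ) * (q₂ : ℂ) * z + n * (v.2 : ℂ) =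
    n * ((v.1 : ℂ) * (q₂ : ℂ) * z + v.2) by ring, mul_pow, div_mul_div_comm]
  ring

/-- The map `(n, v) ↦ n v` from positive integers times primitive vectors to `ℤ × ℤ`. -/
def scaleCoprime (p : ℕ+ × {v : ℤ × ℤ // IsCoprime v.1 v.2}) : ℤ × ℤ :=
  (((p.1 : ℕ) : ℤ) * p.2.1.1, ((p.1 : ℕ) : ℤ) * p.2.1.2)

theorem scaleCoprime_injective : Function.Injective scaleCoprime := by
  rintro ⟨n, ⟨⟨a, b⟩, h⟩⟩ ⟨n', ⟨⟨a', b'⟩, h'⟩⟩ heq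
  simp only [scaleCoprime, Prod.mk.injEq] at heq
  have hg := congrArg₂ Int.gcd heq.1 heq.2
  rw [Int.gcd_mul_left, Int.gcd_mul_left, Int.isCoprime_iff_gcd_eq_one.mp h,
    Int.isCoprime_iff_gcd_eq_one.mp h'] at hg
  have hn : n = n' := PNat.eq (by simpa using hg)
  subst hn
  have hn0 : ((n : ℕ) : ℤ) ≠ 0 := by exact_mod_cast n.ne_zero
  obtain rfl := mul_left_cancel₀ hn0 heq.1
  obtain rfl := mul_left_cancel₀ hn0 heq.2
  rfl

theorem mem_range_scaleCoprime {v : ℤ × ℤ} (hv : v ≠ 0) : v ∈ Set.range scaleCoprime := by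
  have hg : Int.gcd v.1 v.2 ≠ 0 := fun h => hv (by
    rw [Int.gcd_eq_zero_iff] at h; exact Prod.ext h.1 h.2)
  refine ⟨(⟨Int.gcd v.1 v.2, Nat.pos_of_ne_zero hg⟩,
    ⟨(v.1 / (Int.gcd v.1 v.2 : ℤ), v.2 / (Int.gcd v.1 v.2 : ℤ)),
      Int.isCoprime_iff_gcd_eq_one.mpr (Int.gcd_div_gcd_div_gcd (Nat.pos_of_ne_zero hg))⟩), ?_⟩
  exact Prod.ext (Int.mul_ediv_cancel' (Int.gcd_dvd_left ..))
    (Int.mul_ediv_cancel' (Int.gcd_dvd_right ..))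

theorem summable_norm_dirichlet_term (hk : 3 ≤ k) :
    Summable fun n : ℕ => ‖χ₁ (n : ZMod q₁) * χ₂ (n : ZMod q₂) / (n : ℂ) ^ k‖ := by
  refine Summable.of_nonneg_of_le (fun _ => norm_nonneg _) (fun n => ?_)
    (Real.summable_one_div_nat_pow.mpr (show 1 < k by omega))
  rw [norm_div, norm_pow, Complex.norm_natCast]
  gcongr
  exact norm_mul_dirichletCharacter_le_one χ₁ χ₂ _ _

/-- The first term is 1 and the others total at most `ζ(2) - 1 < 1` in norm. -/
theorem tsum_dirichlet_term_ne_zero (hk : 3 ≤ k) :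
    ∑' n : ℕ+, χ₁ (n : ℕ) * χ₂ (n : ℕ) / ((n : ℕ) : ℂ) ^ k ≠ 0 := by
  rw [tsum_pnat_eq_tsum_succ
    (f := fun n : ℕ => χ₁ (n : ZMod q₁) * χ₂ (n : ZMod q₂) / (n : ℂ) ^ k)]
  have hs := (summable_nat_add_iff 1).mpr (summable_norm_dirichlet_term χ₁ χ₂ hk).of_norm
  rw [← hs.sum_add_tsum_nat_add 1]
  have hz := (hasSum_nat_add_iff' 2).mpr hasSum_zeta_two
  have hle := tsum_of_norm_bounded hz (f := fun n : ℕ =>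
    χ₁ ((n + 1 + 1 : ℕ) : ZMod q₁) * χ₂ ((n + 1 + 1 : ℕ) : ZMod q₂) / ((n + 1 + 1 : ℕ) : ℂ) ^ k)
    fun n => by
      rw [norm_div, norm_pow, Complex.norm_natCast]
      gcongr
      · exact norm_mul_dirichletCharacter_le_one χ₁ χ₂ _ _
      · exact_mod_cast (by omega : 1 ≤ n + 1 + 1)
      · omega
  intro h0
  have h1 : (∑' n : ℕ, χ₁ ((n + 1 + 1 : ℕ) : ZMod q₁) * χ₂ ((n + 1 + 1 : ℕ) : ZMod q₂) /
      ((n + 1 + 1 : ℕ) : ℂ) ^ k) = -1 := by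
    simp only [Finset.sum_range_one] at h0
    norm_num at h0 ⊢
    linear_combination h0
  rw [h1, norm_neg, norm_one] at hle
  norm_num [Finset.sum_range_succ] at hle
  nlinarith [Real.pi_lt_d2, Real.pi_pos]

/-- Every nonzero pair is uniquely a positive integer times a coprime pair, and the summand is
multiplicative under this scaling. The origin contributes nothing because `χ₁ 0 = 0`. -/
theorem tsum_newformSummand_eq_mul (hq₁ : 1 < q₁) (hq₂ : 0 < q₂) (hk : 3 ≤ k) (hz : 0 < z.im) :
    ∑' v, newformSummand χ₁ χ₂ k z v =
      (∑' n : ℕ+, χ₁ (n : ℕ) * χ₂ (n : ℕ) / ((n : ℕ) : ℂ) ^ k) *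
        ∑' v : {v : ℤ × ℤ // IsCoprime v.1 v.2}, newformSummand χ₁ χ₂ k z v := by
  have : Fact (1 < q₁) := ⟨hq₁⟩
  have hχ0 : χ₁ 0 = 0 := MulChar.map_nonunit _ not_isUnit_zero
  rw [tsum_mul_tsum_of_summable_norm, ← scaleCoprime_injective.tsum_eq]
  · exact tsum_congr fun p => newformSummand_natMul χ₁ χ₂ _ _
  · intro v hv
    refine mem_range_scaleCoprime fun h0 => hv ?_
    simp [h0, newformSummand, hχ0]
  · exact (summable_norm_dirichlet_term χ₁ χ₂ hk).comp_injective PNat.coe_injective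
  · exact (summable_norm_newformSummand χ₁ χ₂ hq₂ hk hz).subtype _

theorem tsum_newformSummand_eq_two_mul (hq₁ : 1 < q₁) (hq₂ : 0 < q₂) (hk : 3 ≤ k)
    (hz : 0 < z.im) (hpar : χ₁ (-1) * χ₂ (-1) = (-1) ^ k) :
    ∑' v, newformSummand χ₁ χ₂ k z v =
      2 * ∑' c : ℕ+, χ₁ (c : ℕ) *
        ∑' d : ℤ, χ₂ (d : ZMod q₂) / ((q₂ : ℂ) * ((c : ℕ) * z) + d) ^ k := by
  have : Fact (1 < q₁) := ⟨hq₁⟩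
  have hχ0 : χ₁ 0 = 0 := MulChar.map_nonunit _ not_isUnit_zero
  have hs := (summable_norm_newformSummand χ₁ χ₂ hq₂ hk hz).of_norm
  rw [hs.tsum_prod, tsum_int_eq_zero_add_two_mul_tsum_pnat (fun n => ?_) hs.prod]
  · simp only [newformSummand, nsmul_eq_mul, Nat.cast_ofNat]
    rw [show ∑' d : ℤ, χ₁ ((0 : ℤ) : ZMod q₁) * χ₂ (d : ZMod q₂) /
      (((0 : ℤ) : ℂ) * q₂ * z + d) ^ k = 0 by simp [hχ0], zero_add]
    congr 1
    refine tsum_congr fun c => ?_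
    rw [← tsum_mul_left]
    refine tsum_congr fun d => ?_
    push_cast
    rw [mul_div_assoc]
    congr 3
    ring
  · rw [← tsum_comp_neg]
    exact tsum_congr fun d => newformSummand_neg χ₁ χ₂ hpar (n, d)

end

/-! ### Gauss sums and the twisted Lipschitz formula. -/

theorem sum_fin_natCast_zmod {q : ℕ} [NeZero q] (f : ZMod q → ℂ) :
    ∑ j : Fin q, f ((j : ℕ) : ZMod q) = ∑ a, f a := by
  refine Fintype.sum_equiv (ZMod.finEquiv q).toEquiv _ _ fun j => ?_
  congr 1
  obtain ⟨n, rfl⟩ := Nat.exists_eq_succ_of_ne_zero (NeZero.ne q)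
  exact Fin.cast_val_eq_self j

/-- For primitive `χ` the discrete Fourier transform is a multiple of the Gauss sum; were that zero,
injectivity of the transform would give `χ = 0`, against `χ 1 = 1`. -/
theorem gaussSum_stdAddChar_ne_zero {q : ℕ} [NeZero q] {χ : DirichletCharacter ℂ q}
    (hχ : χ.IsPrimitive) : gaussSum χ ZMod.stdAddChar ≠ 0 := by
  intro h
  have h1 : ZMod.dft (χ : ZMod q → ℂ) = 0 := by
    funext a
    rw [hχ.fourierTransform_eq_inv_mul_gaussSum, h, mul_zero, Pi.zero_apply]
  have h2 := congrFun ((LinearEquiv.map_eq_zero_iff _).mp h1) 1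
  simp at h2

theorem sum_dirichlet_mul_stdAddChar {q : ℕ} [NeZero q] {χ : DirichletCharacter ℂ q}
    (hχ : χ.IsPrimitive) (n : ℕ) :
    ∑ j : Fin q, χ ((j : ℕ) : ZMod q) * ZMod.stdAddChar ((n : ZMod q) * ((j : ℕ) : ZMod q)) =
      χ⁻¹ (n : ZMod q) * gaussSum χ ZMod.stdAddChar := by
  rw [sum_fin_natCast_zmod fun a => χ a * ZMod.stdAddChar ((n : ZMod q) * a),
    ← gaussSum_mulShift_of_isPrimitive _ hχ, gaussSum]
  simp only [AddChar.mulShift_apply]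

theorem exp_add_div_pow {q : ℕ} [NeZero q] (τ : ℂ) (j n : ℕ) :
    cexp (2 * Real.pi * I * (τ + (j : ℂ) / q)) ^ n =
      cexp (2 * Real.pi * I * τ) ^ n * ZMod.stdAddChar ((n : ZMod q) * (j : ZMod q)) := by
  have hq0 : (q : ℂ) ≠ 0 := by exact_mod_cast NeZero.ne q
  rw [show (n : ZMod q) * (j : ZMod q) = (((n * j : ℕ) : ℤ) : ZMod q) by push_cast; rfl,
    ZMod.stdAddChar_coe, ← Complex.exp_nat_mul, ← Complex.exp_nat_mul, ← Complex.exp_add]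
  congr 1
  push_cast
  field_simp

/-- Factoring out `q` reduces this to Lipschitz's formula at the shifted point `τ + j / q`; the
shift produces the additive character. -/
theorem tsum_residue_class {q : ℕ} [NeZero q] {N : ℕ} (hN : 1 ≤ N) {τ : ℂ} (hτ : 0 < τ.im)
    (j : ℕ) :
    ∑' m : ℤ, 1 / ((q : ℂ) * τ + ((m * q + j : ℤ) : ℂ)) ^ (N + 1) =
      (-2 * Real.pi * I) ^ (N + 1) / N.factorial / (q : ℂ) ^ (N + 1) *
        ∑' n : ℕ, (n : ℂ) ^ N * cexp (2 * Real.pi * I * τ) ^ n *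
          ZMod.stdAddChar ((n : ZMod q) * (j : ZMod q)) := by
  have hq0 : (q : ℂ) ≠ 0 := by exact_mod_cast NeZero.ne q
  have him : 0 < (τ + (j : ℂ) / q).im := by
    rw [show (j : ℂ) / q = (((j : ℝ) / q : ℝ) : ℂ) by push_cast; rfl, Complex.add_im,
      Complex.ofReal_im, add_zero]
    exact hτ
  have h : ∑' m : ℤ, 1 / (τ + (j : ℂ) / q + m) ^ (N + 1) =
      ((-2 * Real.pi * I) ^ (N + 1) / N.factorial) *
        ∑' n : ℕ, (n : ℂ) ^ N * cexp (2 * Real.pi * I * (τ + (j : ℂ) / q)) ^ n :=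
    EisensteinSeries.qExpansion_identity hN ⟨_, him⟩
  calc _ = ∑' m : ℤ, 1 / (q : ℂ) ^ (N + 1) * (1 / (τ + (j : ℂ) / q + m) ^ (N + 1)) := by
        refine tsum_congr fun m => ?_
        rw [div_mul_div_comm, one_mul, ← mul_pow]
        congr 2
        push_cast
        field_simp
        ring
    _ = _ := by
        rw [tsum_mul_left, h]
        simp only [exp_add_div_pow, ← mul_assoc]
        ring

theorem summable_dirichlet_div_pow {q : ℕ} (χ : DirichletCharacter ℂ q) {N : ℕ} (hN : 1 ≤ N)
    (z : ℂ) : Summable fun d : ℤ => χ (d : ZMod q) / (z + d) ^ (N + 1) := by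
  have h := (EisensteinSeries.linear_right_summable z 1
    (k := ((N + 1 : ℕ) : ℤ)) (by exact_mod_cast (by omega : 2 ≤ N + 1))).norm
  refine Summable.of_norm_bounded h fun d => ?_
  rw [norm_div, zpow_natCast, norm_inv, Int.cast_one, one_mul, div_eq_mul_inv]
  exact mul_le_of_le_one_left (by positivity) (χ.norm_le_one _)

theorem summable_pow_mul_stdAddChar {q : ℕ} [NeZero q] (N j : ℕ) {w : ℂ} (hw : ‖w‖ < 1) :
    Summable fun n : ℕ =>
      (n : ℂ) ^ N * w ^ n * ZMod.stdAddChar ((n : ZMod q) * (j : ZMod q)) := by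
  refine Summable.of_norm_bounded (summable_norm_pow_mul_geometric_of_norm_lt_one N hw) fun n => ?_
  rw [norm_mul, ZMod.stdAddChar_apply, Circle.norm_coe, mul_one]

theorem tsum_int_eq_sum_fin {q : ℕ} [NeZero q] {f : ℤ → ℂ} (hf : Summable f) :
    ∑' d, f d = ∑ j : Fin q, ∑' m : ℤ, f (m * q + (j : ℕ)) := by
  let e : Fin q × ℤ ≃ ℤ := (Equiv.prodComm _ _).trans (Int.divModEquiv q).symm
  have hf' : Summable fun p => f (e p) := e.summable_iff.mpr hf
  rw [← e.tsum_eq, hf'.tsum_prod, tsum_fintype]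
  rfl

/-- Lipschitz's formula twisted by a primitive Dirichlet character. -/
theorem tsum_dirichlet_div_pow {q : ℕ} [NeZero q] {χ : DirichletCharacter ℂ q}
    (hχ : χ.IsPrimitive) {N : ℕ} (hN : 1 ≤ N) {τ : ℂ} (hτ : 0 < τ.im) :
    ∑' d : ℤ, χ (d : ZMod q) / ((q : ℂ) * τ + d) ^ (N + 1) =
      ((-2 * Real.pi * I) ^ (N + 1) / N.factorial / (q : ℂ) ^ (N + 1) *
        gaussSum χ ZMod.stdAddChar) *
        ∑' n : ℕ, χ⁻¹ (n : ZMod q) * ((n : ℂ) ^ N * cexp (2 * Real.pi * I * τ) ^ n) := by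
  have hw : ‖cexp (2 * Real.pi * I * τ)‖ < 1 :=
    UpperHalfPlane.norm_exp_two_pi_I_lt_one ⟨τ, hτ⟩
  obtain ⟨C, hC⟩ : ∃ C, C = (-2 * Real.pi * I) ^ (N + 1) / N.factorial / (q : ℂ) ^ (N + 1) :=
    ⟨_, rfl⟩
  rw [tsum_int_eq_sum_fin (summable_dirichlet_div_pow χ hN _) (q := q), ← hC]
  have hinner (j : Fin q) : ∑' m : ℤ, χ ((m * q + (j : ℕ) : ℤ) : ZMod q) /
      ((q : ℂ) * τ + ((m * q + (j : ℕ) : ℤ) : ℂ)) ^ (N + 1) =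
      ∑' n : ℕ, C * χ ((j : ℕ) : ZMod q) * ((n : ℂ) ^ N * cexp (2 * Real.pi * I * τ) ^ n *
        ZMod.stdAddChar ((n : ZMod q) * ((j : ℕ) : ZMod q))) := by
    rw [tsum_mul_left, mul_comm C, mul_assoc, hC, ← tsum_residue_class hN hτ, ← tsum_mul_left]
    refine tsum_congr fun m => ?_
    rw [mul_one_div]
    congr 2
    push_cast
    rw [ZMod.natCast_self, mul_zero, zero_add]
  rw [Finset.sum_congr rfl fun j _ => hinner j, ← Summable.tsum_finsetSum, ← tsum_mul_left]
  · refine tsum_congr fun n => ?_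
    calc _ = C * ((n : ℂ) ^ N * cexp (2 * Real.pi * I * τ) ^ n) *
          ∑ j : Fin q, χ ((j : ℕ) : ZMod q) *
            ZMod.stdAddChar ((n : ZMod q) * ((j : ℕ) : ZMod q)) := by
          rw [Finset.mul_sum]
          exact Finset.sum_congr rfl fun j _ => by ring
      _ = _ := by
          rw [sum_dirichlet_mul_stdAddChar hχ n]
          ring
  · exact fun j _ => (summable_pow_mul_stdAddChar N j hw).mul_left _

/-! ### Fourier expansion and its coefficients. -/

/-- The coefficients of the Fourier expansion of the newform Eisenstein series, divided by
`m ^ N`. -/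
noncomputable def twistedDivisorSum {q₁ q₂ : ℕ} (χ₁ : DirichletCharacter ℂ q₁)
    (χ₂ : DirichletCharacter ℂ q₂) (N m : ℕ) : ℂ :=
  ∑ p ∈ m.divisorsAntidiagonal, χ₁ (p.1 : ZMod q₁) * χ₂⁻¹ (p.2 : ZMod q₂) / (p.1 : ℂ) ^ N

section

variable {q₁ q₂ : ℕ} (χ₁ : DirichletCharacter ℂ q₁) (χ₂ : DirichletCharacter ℂ q₂)

theorem summable_twisted_prod (N : ℕ) {w : ℂ} (hw : ‖w‖ < 1) :
    Summable fun p : ℕ+ × ℕ+ => χ₁ ((p.1 : ℕ) : ZMod q₁) * χ₂⁻¹ ((p.2 : ℕ) : ZMod q₂) *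
      (((p.2 : ℕ) : ℂ) ^ N * w ^ ((p.1 : ℕ) * (p.2 : ℕ))) := by
  refine Summable.of_norm_bounded (summable_prod_mul_pow N hw).norm fun p => ?_
  rw [norm_mul]
  exact mul_le_of_le_one_left (norm_nonneg _) (norm_mul_dirichletCharacter_le_one χ₁ _ _ _)

/-- Collect the terms with `c n = m` and write `n ^ N = m ^ N / c ^ N`. Index 0 drops out since `N ≠
0`. -/
theorem tsum_tsum_eq_weightedPowerSeries {N : ℕ} (hN : 1 ≤ N) {w : ℂ} (hw : ‖w‖ < 1) :
    ∑' c : ℕ+, χ₁ ((c : ℕ) : ZMod q₁) *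
        ∑' n : ℕ, χ₂⁻¹ (n : ZMod q₂) * ((n : ℂ) ^ N * (w ^ (c : ℕ)) ^ n) =
      weightedPowerSeries N (twistedDivisorSum χ₁ χ₂ N) w := by
  have hs := summable_twisted_prod χ₁ χ₂ N hw
  have hN0 : N ≠ 0 := by omega
  have h1 (c : ℕ+) : χ₁ ((c : ℕ) : ZMod q₁) *
        ∑' n : ℕ, χ₂⁻¹ (n : ZMod q₂) * ((n : ℂ) ^ N * (w ^ (c : ℕ)) ^ n) =
      ∑' n : ℕ+, χ₁ ((c : ℕ) : ZMod q₁) * χ₂⁻¹ ((n : ℕ) : ZMod q₂) *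
        (((n : ℕ) : ℂ) ^ N * w ^ ((c : ℕ) * (n : ℕ))) := by
    rw [← PNat.coe_injective.tsum_eq, ← tsum_mul_left]
    · exact tsum_congr fun n => by rw [pow_mul]; ring
    · intro n hn
      refine ⟨⟨n, Nat.pos_of_ne_zero fun h0 => hn ?_⟩, rfl⟩
      simp [h0, hN0]
  have h2 : weightedPowerSeries N (twistedDivisorSum χ₁ χ₂ N) w =
      ∑' m : ℕ+, ((m : ℕ) : ℂ) ^ N * twistedDivisorSum χ₁ χ₂ N m * w ^ (m : ℕ) := by
    rw [weightedPowerSeries, ← PNat.coe_injective.tsum_eq]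
    intro n hn
    refine ⟨⟨n, Nat.pos_of_ne_zero fun h0 => hn ?_⟩, rfl⟩
    simp [h0, hN0]
  have hs' := sigmaAntidiagonalEquivProd.summable_iff.mpr hs
  rw [tsum_congr h1, ← hs.tsum_prod, h2, ← sigmaAntidiagonalEquivProd.tsum_eq]
  refine hs'.tsum_sigma.trans (tsum_congr fun m => ?_)
  rw [tsum_fintype, twistedDivisorSum, Finset.mul_sum, Finset.sum_mul,
    ← Finset.sum_coe_sort (m : ℕ).divisorsAntidiagonal]
  refine Finset.sum_congr rfl fun p _ => ?_
  have hp := Nat.mem_divisorsAntidiagonal.mp p.2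
  have hp0 : ((p.1.1 : ℕ) : ℂ) ≠ 0 := by
    have : p.1.1 ≠ 0 := fun h => hp.2 (by rw [← hp.1, h, zero_mul])
    exact_mod_cast this
  change χ₁ ((p.1.1 : ℕ) : ZMod q₁) * χ₂⁻¹ ((p.1.2 : ℕ) : ZMod q₂) *
    ((p.1.2 : ℂ) ^ N * w ^ (p.1.1 * p.1.2)) = _
  rw [hp.1, show ((m : ℕ) : ℂ) = p.1.1 * p.1.2 by exact_mod_cast hp.1.symm, mul_pow]
  field_simp

/-- Fourier expansion of the newform Eisenstein series. -/
theorem exists_newformEisenstein_eq_weightedPowerSeries {N : ℕ} (hN : 2 ≤ N) (hq₁ : 1 < q₁)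
    (hq₂ : 0 < q₂) (hχ₂ : χ₂.IsPrimitive) (hpar : χ₁ (-1) * χ₂ (-1) = (-1) ^ (N + 1)) :
    ∃ C : ℂ, C ≠ 0 ∧ ∀ z : ℂ, 0 < z.im → newformEisenstein χ₁ χ₂ (N + 1) z =
      C * weightedPowerSeries N (twistedDivisorSum χ₁ χ₂ N) (cexp (2 * Real.pi * I * z)) := by
  have : NeZero q₂ := ⟨hq₂.ne'⟩
  have hk : 3 ≤ N + 1 := by omega
  obtain ⟨D, hD⟩ : ∃ D, D = (-2 * Real.pi * I) ^ (N + 1) / N.factorial / (q₂ : ℂ) ^ (N + 1) *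
    gaussSum χ₂ ZMod.stdAddChar := ⟨_, rfl⟩
  have hD0 : D ≠ 0 := by
    rw [hD]
    refine mul_ne_zero (div_ne_zero (div_ne_zero (pow_ne_zero _ ?_) ?_) ?_)
      (gaussSum_stdAddChar_ne_zero hχ₂)
    · simp [Real.pi_ne_zero]
    · exact_mod_cast N.factorial_ne_zero
    · exact pow_ne_zero _ (by exact_mod_cast hq₂.ne')
  have hL := tsum_dirichlet_term_ne_zero χ₁ χ₂ hk
  refine ⟨D / ∑' n : ℕ+, χ₁ (n : ℕ) * χ₂ (n : ℕ) / ((n : ℕ) : ℂ) ^ (N + 1), div_ne_zero hD0 hL,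
    fun z hz => ?_⟩
  have hw : ‖cexp (2 * Real.pi * I * z)‖ < 1 :=
    UpperHalfPlane.norm_exp_two_pi_I_lt_one ⟨z, hz⟩
  have h1 := tsum_newformSummand_eq_mul χ₁ χ₂ hq₁ hq₂ hk hz
  rw [tsum_newformSummand_eq_two_mul χ₁ χ₂ hq₁ hq₂ hk hz hpar] at h1
  have h2 : ∑' c : ℕ+, χ₁ (c : ℕ) *
        ∑' d : ℤ, χ₂ (d : ZMod q₂) / ((q₂ : ℂ) * ((c : ℕ) * z) + d) ^ (N + 1) =
      D * weightedPowerSeries N (twistedDivisorSum χ₁ χ₂ N) (cexp (2 * Real.pi * I * z)) := by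
    rw [← tsum_tsum_eq_weightedPowerSeries χ₁ χ₂ (by omega) hw, ← tsum_mul_left]
    refine tsum_congr fun c => ?_
    rw [tsum_dirichlet_div_pow hχ₂ (by omega) (natCast_mul_im_pos c.pos hz), ← hD,
      ← Complex.exp_nat_mul, mul_left_comm, mul_left_comm (2 * (Real.pi : ℂ) * I)]
  rw [h2] at h1
  change 1 / 2 * ∑' v : {v : ℤ × ℤ // IsCoprime v.1 v.2}, newformSummand χ₁ χ₂ (N + 1) z v = _
  rw [div_mul_eq_mul_div D, eq_div_iff hL]
  linear_combination -(1 / 2 : ℂ) * h1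

/-- The divisor `c = 1` gives `χ₂⁻¹ m`. For `c ≥ 2`, `c ^ N ≥ 2 ^ 8 c ^ 2`, so the rest is at most
`1/256` times a sum of inverse squares bounded by 1. -/
theorem norm_twistedDivisorSum_sub_le {N m : ℕ} (hN : 10 ≤ N) (hm : 1 ≤ m) :
    ‖twistedDivisorSum χ₁ χ₂ N m - χ₂⁻¹ (m : ZMod q₂)‖ ≤ 1 / 100 := by
  rw [twistedDivisorSum, Nat.sum_divisorsAntidiagonal
    (fun a b => χ₁ (a : ZMod q₁) * χ₂⁻¹ (b : ZMod q₂) / (a : ℂ) ^ N),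
    ← Finset.add_sum_erase _ _ (Nat.one_mem_divisors.mpr (by omega : m ≠ 0))]
  simp only [Nat.cast_one, map_one, Nat.div_one, one_mul, one_pow, div_one, add_sub_cancel_left]
  have hterm (c : ℕ) (hc : c ∈ m.divisors.erase 1) :
      ‖χ₁ (c : ZMod q₁) * χ₂⁻¹ ((m / c : ℕ) : ZMod q₂) / (c : ℂ) ^ N‖ ≤
        1 / 256 * ((c : ℝ) ^ 2)⁻¹ := by
    rw [Finset.mem_erase, Nat.mem_divisors] at hc
    have hc2 : 2 ≤ c := by
      have : c ≠ 0 := by rintro rfl; simp at hc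
      omega
    have hc2' : (2 : ℝ) ≤ c := by exact_mod_cast hc2
    rw [norm_div, norm_pow, Complex.norm_natCast]
    have hp : 256 * (c : ℝ) ^ 2 ≤ (c : ℝ) ^ N := by
      calc 256 * (c : ℝ) ^ 2 = 2 ^ 8 * (c : ℝ) ^ 2 := by norm_num
        _ ≤ (c : ℝ) ^ 8 * (c : ℝ) ^ 2 := by gcongr
        _ = (c : ℝ) ^ 10 := by ring
        _ ≤ _ := pow_le_pow_right₀ (by linarith) hN
    calc _ ≤ 1 / (c : ℝ) ^ N := by gcongr; exact norm_mul_dirichletCharacter_le_one χ₁ _ _ _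
      _ ≤ 1 / (256 * (c : ℝ) ^ 2) := by gcongr
      _ = _ := by field_simp
  refine (norm_sum_le_of_le _ hterm).trans ?_
  rw [← Finset.mul_sum]
  have hsub : m.divisors.erase 1 ⊆ Finset.Ioc 1 m := fun c hc => by
    rw [Finset.mem_erase, Nat.mem_divisors] at hc
    have h0 : c ≠ 0 := by rintro rfl; simp at hc
    exact Finset.mem_Ioc.mpr ⟨by omega, Nat.le_of_dvd (by omega) hc.2.1⟩
  have h1 : ∑ c ∈ m.divisors.erase 1, ((c : ℝ) ^ 2)⁻¹ ≤ 1 := by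
    refine (Finset.sum_le_sum_of_subset_of_nonneg hsub fun _ _ _ => by positivity).trans
      ((sum_Ioc_inv_sq_le_sub one_ne_zero hm).trans ?_)
    simp
  linarith

theorem norm_twistedDivisorSum_le {N : ℕ} (hN : 10 ≤ N) (m : ℕ) :
    ‖twistedDivisorSum χ₁ χ₂ N m‖ ≤ 2 := by
  rcases Nat.eq_zero_or_pos m with rfl | hm
  · simp [twistedDivisorSum]
  · have h1 := norm_twistedDivisorSum_sub_le χ₁ χ₂ hN hm
    have h2 := norm_sub_norm_le (twistedDivisorSum χ₁ χ₂ N m) (χ₂⁻¹ (m : ZMod q₂))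
    linarith [(χ₂⁻¹).norm_le_one (m : ZMod q₂)]

theorem norm_dirichletCharacter_natCast {m : ℕ} (hm : m.Coprime q₂) :
    ‖χ₂ (m : ZMod q₂)‖ = 1 := by
  simpa using χ₂.unit_norm_eq_one (ZMod.unitOfCoprime m hm)

theorem one_half_le_norm_twistedDivisorSum {N m : ℕ} (hN : 10 ≤ N) (hm : 1 ≤ m)
    (hmq : m.Coprime q₂) : 1 / 2 ≤ ‖twistedDivisorSum χ₁ χ₂ N m‖ := by
  have h1 := norm_twistedDivisorSum_sub_le χ₁ χ₂ hN hm
  have h2 := norm_sub_norm_le (χ₂⁻¹ (m : ZMod q₂)) (twistedDivisorSum χ₁ χ₂ N m)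
  rw [norm_sub_rev, norm_dirichletCharacter_natCast (χ₂⁻¹) hmq] at h2
  linarith

end

/-! ### Passing between `z` and `e ^ (2 π i z)`. -/

/-- A number `w ≠ 0` has a logarithm `z`, `e ^ (2 π i z) = w`, with real part in
`(x₀ - 1 / 2, x₀ + 1 / 2]`. -/
theorem exists_exp_two_pi_I_mul_eq {w : ℂ} (hw : w ≠ 0) (x₀ : ℝ) :
    ∃ z : ℂ, cexp (2 * Real.pi * I * z) = w ∧ x₀ - 1 / 2 < z.re ∧ z.re ≤ x₀ + 1 / 2 := by
  have hπ : (Real.pi : ℂ) ≠ 0 := by exact_mod_cast Real.pi_ne_zero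
  set u := w * cexp (-(2 * Real.pi * I * x₀)) with hu
  have hu0 : u ≠ 0 := mul_ne_zero hw (exp_ne_zero _)
  refine ⟨x₀ + log u / (2 * Real.pi * I), ?_, ?_⟩
  · rw [mul_add, mul_div_cancel₀ _ (by simp [hπ]), exp_add, exp_log hu0, hu, mul_left_comm,
      ← exp_add, add_neg_cancel, exp_zero, mul_one]
  · have hre : (log u / (2 * Real.pi * I)).re = u.arg / (2 * Real.pi) := by
      rw [show log u / (2 * Real.pi * I) = ((1 / (2 * Real.pi) : ℝ) : ℂ) * (-I * log u) by
        push_cast; field_simp; rw [I_sq]; ring, re_ofReal_mul]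
      simp [log_im]
      ring
    rw [add_re, ofReal_re, hre]
    have h1 := neg_pi_lt_arg u
    have h2 := arg_le_pi u
    have h3 : -(1 / 2) < u.arg / (2 * Real.pi) := by
      rw [lt_div_iff₀ Real.two_pi_pos]; linarith
    have h4 : u.arg / (2 * Real.pi) ≤ 1 / 2 := by
      rw [div_le_iff₀ Real.two_pi_pos]; linarith
    constructor <;> linarith

theorem norm_exp_two_pi_I_mul (z : ℂ) :
    ‖cexp (2 * Real.pi * I * z)‖ = Real.exp (-(2 * Real.pi * z.im)) := by
  rw [norm_exp]
  congr 1
  simp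

theorem eq_of_exp_two_pi_I_mul_eq {z w : ℂ}
    (h : cexp (2 * Real.pi * I * z) = cexp (2 * Real.pi * I * w)) (hlt : |z.re - w.re| < 1) :
    z = w := by
  have hπ : (Real.pi : ℂ) ≠ 0 := by exact_mod_cast Real.pi_ne_zero
  obtain ⟨n, hn⟩ := exp_eq_exp_iff_exists_int.mp h
  have hz : z = w + n := by
    have : 2 * (Real.pi : ℂ) * I ≠ 0 := by simp [hπ]
    apply mul_left_cancel₀ this
    linear_combination hn
  have hn0 : n = 0 := by
    rw [hz] at hlt
    simp only [add_re, intCast_re, add_sub_cancel_left] at hlt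
    have : |n| < 1 := by exact_mod_cast hlt
    exact Int.abs_lt_one_iff.mp this
  simpa [hn0] using hz

theorem exp_eq_neg_of_re_eq {x₀ : ℝ} {z : ℂ} (h : z.re = x₀ - 1 / 2 ∨ z.re = x₀ + 1 / 2) :
    cexp (2 * Real.pi * I * z) =
      -((Real.exp (-(2 * Real.pi * z.im)) : ℝ) * cexp (2 * Real.pi * I * x₀)) := by
  have hz : z = (z.re : ℂ) + z.im * I := (re_add_im z).symm
  have he : cexp (2 * Real.pi * I * z) =
      (Real.exp (-(2 * Real.pi * z.im)) : ℝ) * cexp (2 * Real.pi * I * z.re) := by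
    conv_lhs => rw [hz]
    rw [ofReal_exp, ← exp_add]
    congr 1
    push_cast
    linear_combination (2 * (Real.pi : ℂ) * z.im) * I_sq
  rw [he, ← mul_neg]
  rcases h with h | h
  · rw [h]
    push_cast
    rw [show 2 * (Real.pi : ℂ) * I * (x₀ - 1 / 2) = 2 * Real.pi * I * x₀ - Real.pi * I by ring,
      exp_sub, exp_pi_mul_I]
    ring
  · rw [h]
    push_cast
    rw [show 2 * (Real.pi : ℂ) * I * (x₀ + 1 / 2) = 2 * Real.pi * I * x₀ + Real.pi * I by ring,
      exp_add, exp_pi_mul_I]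
    ring

theorem yHeight_le_im_iff {N n : ℕ} (hn : 0 < n) (z : ℂ) :
    yHeight (N + 1) n ≤ z.im ↔ ‖cexp (2 * Real.pi * I * z)‖ ≤ Real.exp (-(N / n)) := by
  have hn' : (0 : ℝ) < n := by exact_mod_cast hn
  have hπ := Real.pi_pos
  rw [norm_exp_two_pi_I_mul, Real.exp_le_exp, neg_le_neg_iff, yHeight, div_le_iff₀ (by positivity),
    div_le_iff₀ hn']
  push_cast
  rw [add_sub_cancel_right, show z.im * (2 * Real.pi * n) = 2 * Real.pi * z.im * n by ring]

theorem im_le_yHeight_iff {N n : ℕ} (hn : 0 < n) (z : ℂ) :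
    z.im ≤ yHeight (N + 1) n ↔ Real.exp (-(N / n)) ≤ ‖cexp (2 * Real.pi * I * z)‖ := by
  have hn' : (0 : ℝ) < n := by exact_mod_cast hn
  have hπ := Real.pi_pos
  rw [norm_exp_two_pi_I_mul, Real.exp_le_exp, neg_le_neg_iff, yHeight, le_div_iff₀ (by positivity),
    le_div_iff₀ hn']
  push_cast
  rw [add_sub_cancel_right, show z.im * (2 * Real.pi * n) = 2 * Real.pi * z.im * n by ring]

/-- A simple zero of `F` at `e ^ (2 π i z)` is a simple zero of `z ↦ C F(e ^ (2 π i z))`. -/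
theorem analyticOrderAt_eq_one_of_comp_exp {f F : ℂ → ℂ} {C : ℂ} (hC : C ≠ 0)
    (hF : DifferentiableOn ℂ F (Metric.ball 0 1))
    (hf : ∀ z : ℂ, 0 < z.im → f z = C * F (cexp (2 * Real.pi * I * z))) {z : ℂ} (hz : 0 < z.im)
    (h0 : F (cexp (2 * Real.pi * I * z)) = 0)
    (hd : deriv F (cexp (2 * Real.pi * I * z)) ≠ 0) : analyticOrderAt f z = 1 := by
  have hπ : (Real.pi : ℂ) ≠ 0 := by exact_mod_cast Real.pi_ne_zero
  have hopen : IsOpen {z : ℂ | 0 < z.im} := isOpen_lt continuous_const continuous_im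
  have hderiv (u : ℂ) (hu : 0 < u.im) : HasDerivAt f (C * (deriv F (cexp (2 * Real.pi * I * u)) *
      (cexp (2 * Real.pi * I * u) * (2 * Real.pi * I)))) u := by
    have hlt : cexp (2 * Real.pi * I * u) ∈ Metric.ball (0 : ℂ) 1 := by
      rw [mem_ball_zero_iff]
      exact UpperHalfPlane.norm_exp_two_pi_I_lt_one ⟨u, hu⟩
    have h1 : HasDerivAt (fun v => 2 * Real.pi * I * v) (2 * Real.pi * I) u := by
      simpa using (hasDerivAt_id u).const_mul (2 * Real.pi * I : ℂ)
    have h2 := ((hF.differentiableAt (Metric.isOpen_ball.mem_nhds hlt)).hasDerivAt.comp u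
      h1.cexp).const_mul C
    refine h2.congr_of_eventuallyEq ?_
    filter_upwards [hopen.mem_nhds hu] with v hv using hf v hv
  have hdiff : DifferentiableOn ℂ f {z : ℂ | 0 < z.im} := fun u hu =>
    (hderiv u hu).differentiableAt.differentiableWithinAt
  refine (hdiff.analyticAt (hopen.mem_nhds hz)).analyticOrderAt_eq_one_of_zero_deriv_ne_zero ?_ ?_
  · rw [hf z hz, h0, mul_zero]
  · rw [(hderiv z hz).deriv]
    exact mul_ne_zero hC (mul_ne_zero hd (mul_ne_zero (exp_ne_zero _) (by simp [hπ])))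

theorem re_pos_of_norm_sub_one_lt {z : ℂ} (h : ‖z - 1‖ < 1) : 0 < z.re := by
  have := (abs_re_le_norm (z - 1)).trans_lt h
  rw [sub_re, one_re, abs_lt] at this
  linarith

/-- The solution of `Q b' w = - P b s`, where `b`, `b'`, `s` are close to `α`, `β`, `1`, is not
a negative multiple of `- α / β`. -/
theorem ne_neg_real_mul {P Q t : ℝ} (hP : 0 < P) (hQ : 0 < Q) (ht : 0 < t)
    {α β b b' s w : ℂ} (hα : ‖α‖ = 1) (hβ : ‖β‖ = 1) (hb : ‖b - α‖ ≤ 1 / 100)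
    (hb' : ‖b' - β‖ ≤ 1 / 100) (hs : ‖s - 1‖ ≤ 1 / 100)
    (h : (Q : ℂ) * b' * w = -((P : ℂ) * b * s)) : w ≠ -((t : ℂ) * -(α / β)) := by
  rintro rfl
  have hα0 : α ≠ 0 := norm_pos_iff.mp (by rw [hα]; norm_num)
  have hβ0 : β ≠ 0 := norm_pos_iff.mp (by rw [hβ]; norm_num)
  have h1 : ‖b / α - 1‖ ≤ 1 / 100 := by
    rw [div_sub_one hα0, norm_div, hα, div_one]; exact hb
  have h2 : ‖b' / β - 1‖ ≤ 1 / 100 := by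
    rw [div_sub_one hβ0, norm_div, hβ, div_one]; exact hb'
  have h3 : ‖b / α * s - 1‖ < 1 := by
    calc ‖b / α * s - 1‖ = ‖(b / α - 1) * (s - 1) + (b / α - 1) + (s - 1)‖ := by congr 1; ring
      _ ≤ ‖b / α - 1‖ * ‖s - 1‖ + ‖b / α - 1‖ + ‖s - 1‖ := by
        rw [← norm_mul]
        exact (norm_add_le _ _).trans (by gcongr; exact norm_add_le _ _)
      _ ≤ 1 / 100 * (1 / 100) + 1 / 100 + 1 / 100 := by gcongr
      _ < 1 := by norm_num
  have h4 := re_pos_of_norm_sub_one_lt h3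
  have h5 := re_pos_of_norm_sub_one_lt (h2.trans_lt (by norm_num))
  -- The two sides have real parts of opposite signs, since `b' / β` and `(b / α) s` are close to 1.
  have h6 : ((Q * t : ℝ) : ℂ) * (b' / β) = ((-P : ℝ) : ℂ) * (b / α * s) := by
    push_cast
    field_simp
    field_simp at h
    linear_combination h
  have h7 := congrArg re h6
  rw [re_ofReal_mul, re_ofReal_mul] at h7
  have h8 : 0 < Q * t * (b' / β).re := by positivity
  have h9 : 0 < P * (b / α * s).re := by positivity
  linarith

/-! ### Choice of constants and conclusion. -/

theorem forty_mul_sq_le {k l : ℕ} (hk : 3 ≤ k) (hl : 1 ≤ l)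
    (h : (l : ℝ) ≤ 1 / 20 * Real.sqrt k) : 40 * (l + 1) ^ 2 ≤ k - 1 := by
  have hl' : (1 : ℝ) ≤ l := by exact_mod_cast hl
  have hk' : (3 : ℝ) ≤ k := by exact_mod_cast hk
  have h1 : (l : ℝ) ^ 2 ≤ k / 400 := by
    calc (l : ℝ) ^ 2 ≤ (1 / 20 * Real.sqrt k) ^ 2 := by gcongr
      _ = (k : ℝ) / 400 := by rw [mul_pow, Real.sq_sqrt (by positivity)]; ring
  have h2 : (40 : ℝ) * (l + 1) ^ 2 + 1 ≤ k := by nlinarith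
  have h3 : 40 * (l + 1) ^ 2 + 1 ≤ k := by exact_mod_cast h2
  omega

theorem theorem1p2 :
    ∃ ε : ℝ, 0 < ε ∧ ∃ K : ℕ,
      ∀ (q₁ q₂ : ℕ) (χ₁ : DirichletCharacter ℂ q₁) (χ₂ : DirichletCharacter ℂ q₂) (k l : ℕ),
        1 < q₁ → 1 < q₂ → χ₁.IsPrimitive → χ₂.IsPrimitive →
        3 ≤ k → χ₁ (-1) * χ₂ (-1) = (-1) ^ k →
        K ≤ k → 1 ≤ l → Nat.Coprime l q₂ → Nat.Coprime (l + 1) q₂ →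
        (l : ℝ) ≤ ε * Real.sqrt (k : ℝ) →
        HasExactlyOneZeroIn (newformEisenstein χ₁ χ₂ k) (stripRegion k l) ∧
        ∀ x₀ : ℝ, -(1 / 2 : ℝ) < x₀ → x₀ ≤ 1 / 2 →
          Complex.exp (2 * Real.pi * Complex.I * x₀) =
            -(starRingEnd ℂ (χ₂ (l : ZMod q₂)) * χ₂ ((l + 1 : ℕ) : ZMod q₂)) →
          HasExactlyOneZeroIn (newformEisenstein χ₁ χ₂ k) (centredRegion x₀ k l) := by
  -- With `ε = 1/20`, `40 (l + 1) ^ 2 ≤ 160 l ^ 2 ≤ 2 k / 5`. Moreover `l ≥ 1` already forces `k ≥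
  -- 400`, so `K = 3` is enough.
  refine ⟨1 / 20, by norm_num, 3, fun q₁ q₂ χ₁ χ₂ k l hq₁ hq₂ _ hχ₂ hk hpar _ hl hlq hlq' hlk => ?_⟩
  have hN := forty_mul_sq_le hk hl hlk
  obtain ⟨N, rfl⟩ : ∃ N, k = N + 1 := ⟨k - 1, by omega⟩
  rw [Nat.add_sub_cancel] at hN
  have hN10 : 10 ≤ N := by nlinarith
  obtain ⟨C, hC, hE⟩ := exists_newformEisenstein_eq_weightedPowerSeries χ₁ χ₂ (by omega) hq₁
    (by omega) hχ₂ hpar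
  have hb := norm_twistedDivisorSum_le χ₁ χ₂ hN10
  obtain ⟨w, ⟨hw1, hw2⟩, hw0, hdw, huniq, s, hs, hws⟩ :=
    exists_unique_zero_weightedPowerSeries hl hN hb
      (one_half_le_norm_twistedDivisorSum χ₁ χ₂ hN10 hl hlq)
      (one_half_le_norm_twistedDivisorSum χ₁ χ₂ hN10 (by omega) hlq')
  have hwne : w ≠ 0 := norm_pos_iff.mp ((Real.exp_pos _).trans_le hw1)
  have him (z : ℂ) : (yHeight (N + 1) (l + 1) ≤ z.im ∧ z.im ≤ yHeight (N + 1) l) ↔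
      (Real.exp (-(N / l)) ≤ ‖cexp (2 * Real.pi * I * z)‖ ∧
        ‖cexp (2 * Real.pi * I * z)‖ ≤ Real.exp (-(N / (l + 1)))) := by
    rw [yHeight_le_im_iff (by omega), im_le_yHeight_iff (by omega), and_comm]
    push_cast
    rfl
  have hpos (z : ℂ) (hz : yHeight (N + 1) (l + 1) ≤ z.im) : 0 < z.im := by
    refine lt_of_lt_of_le ?_ hz
    have h1 : (0 : ℝ) < N := by exact_mod_cast (by omega : 0 < N)
    have := Real.pi_pos
    rw [yHeight]
    push_cast
    rw [add_sub_cancel_right]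
    positivity
  have hzero (z : ℂ) (hz1 : yHeight (N + 1) (l + 1) ≤ z.im) (hz2 : z.im ≤ yHeight (N + 1) l)
      (hz : newformEisenstein χ₁ χ₂ (N + 1) z = 0) : cexp (2 * Real.pi * I * z) = w := by
    rw [hE z (hpos z hz1)] at hz
    have h := (him z).mp ⟨hz1, hz2⟩
    exact huniq _ h.1 h.2 ((mul_eq_zero.mp hz).resolve_left hC)
  have hroot (z : ℂ) (hz : cexp (2 * Real.pi * I * z) = w) :
      (yHeight (N + 1) (l + 1) ≤ z.im ∧ z.im ≤ yHeight (N + 1) l) ∧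
      newformEisenstein χ₁ χ₂ (N + 1) z = 0 ∧
      analyticOrderAt (newformEisenstein χ₁ χ₂ (N + 1)) z = 1 := by
    have h := (him z).mpr (hz.symm ▸ ⟨hw1, hw2⟩)
    refine ⟨h, ?_, ?_⟩
    · rw [hE z (hpos z h.1), hz, hw0, mul_zero]
    · exact analyticOrderAt_eq_one_of_comp_exp hC (differentiableOn_weightedPowerSeries hb) hE
        (hpos z h.1) (hz.symm ▸ hw0) (hz.symm ▸ hdw)
  constructor
  · obtain ⟨z, hz, hz1, hz2⟩ := exists_exp_two_pi_I_mul_eq hwne 0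
    obtain ⟨h1, h2, h3⟩ := hroot z hz
    refine ⟨z, ⟨by linarith, by linarith, h1⟩, h2, h3, ?_⟩
    rintro v ⟨hv1, hv2, hv3, hv4⟩ hv
    refine eq_of_exp_two_pi_I_mul_eq ((hzero v hv3 hv4 hv).trans hz.symm) ?_
    rw [abs_lt]
    constructor <;> linarith
  · intro x₀ _ _ hx₀
    -- Keeping zeros off both edges makes real parts differ by less than 1, so equal exponentials
    -- give equal points.
    have hne (v : ℂ) (hv : cexp (2 * Real.pi * I * v) = w) :
        v.re ≠ x₀ - 1 / 2 ∧ v.re ≠ x₀ + 1 / 2 := by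
      rw [← not_or]
      intro hor
      have h := exp_eq_neg_of_re_eq hor
      have hαβ : starRingEnd ℂ (χ₂ (l : ZMod q₂)) * χ₂ ((l + 1 : ℕ) : ZMod q₂) =
          χ₂⁻¹ (l : ZMod q₂) / χ₂⁻¹ ((l + 1 : ℕ) : ZMod q₂) := by
        rw [MulChar.inv_apply_eq_inv', MulChar.inv_apply_eq_inv', div_inv_eq_mul,
          Complex.inv_eq_conj (norm_dirichletCharacter_natCast χ₂ hlq)]
      rw [hv, hx₀, hαβ] at h
      refine ne_neg_real_mul (P := (l : ℝ) ^ N) (Q := ((l + 1 : ℕ) : ℝ) ^ N) (by positivity)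
        (by positivity) (Real.exp_pos _) (norm_dirichletCharacter_natCast χ₂⁻¹ hlq)
        (norm_dirichletCharacter_natCast χ₂⁻¹ hlq')
        (norm_twistedDivisorSum_sub_le χ₁ χ₂ hN10 hl)
        (norm_twistedDivisorSum_sub_le χ₁ χ₂ hN10 (by omega)) hs ?_ h
      simpa only [ofReal_pow, ofReal_natCast] using hws
    obtain ⟨z, hz, hz1, hz2⟩ := exists_exp_two_pi_I_mul_eq hwne x₀
    obtain ⟨h1, h2, h3⟩ := hroot z hz
    refine ⟨z, ⟨hz1.le, hz2, h1⟩, h2, h3, ?_⟩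
    rintro v ⟨hv1, hv2, hv3, hv4⟩ hv
    have hvw := hzero v hv3 hv4 hv
    refine eq_of_exp_two_pi_I_mul_eq (hvw.trans hz.symm) ?_
    have h5 := lt_of_le_of_ne hv1 (hne v hvw).1.symm
    have h6 := lt_of_le_of_ne hv2 (hne v hvw).2
    rw [abs_lt]
    constructor <;> linarith
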